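/- **Theorem.** Let $d\ge 3$ be odd and let $w=(w_1,\dots,w_d)$ be integers with $w_i\ge 2$ for all $i$; put $w_{d+1}:=w_1$. All polynomials are noncommutative, over $\mathbb{C}$, in the variables $x^{(i)}_{(a,b)}$ with $1\le i\le d$, $1\le a\le w_i$, $1\le b\le w_{i+1}$. A *trace ABP of format $w$* is given by homogeneous linear forms $\ell^{(i)}_{a,b}$ in these variables ($1\le i\le d$, $1\le a\le w_i$, $1\le b\le w_{i+1}$); it computes $$\sum_{k_1\in[w_1],\dots,k_d\in[w_d]} \ell^{(1)}_{k_1,k_2}\,\ell^{(2)}_{k_2,k_3}\cdots \ell^{(d)}_{k_d,k_1}.$$ (The same definition applies to every format $(w'_1,\dots,w'_d)$ with the same set of variables.) Its width is $\max_i w_i$. For a homogeneous polynomial $f$ of degree $d$, let $\mathsf{ncw}(f)$ be the least width of a trace ABP computing $f$, and let $\underline{\mathsf{ncw}}(f)$ be the least $r$ such that $f$ is a coefficientwise limit of polynomials computed by trace ABPs (with $d$ layers of edges) of width at most $r$. For $\varepsilon\in\mathbb{C}$ let $f'_\varepsilon$ be the polynomial computed by the trace ABP of format $w$ with labels $\ell^{(i)}_{a,b}=\varepsilon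 x^{(i)}_{(a,b)}$ if $a\equiv b\pmod 2$ and $\ell^{(i)}_{a,b}=x^{(i)}_{(a,b)}$ otherwise, and for $\varepsilon\ne0$ let $f_\varepsilon=\frac1\varepsilon f'_\varepsilon$. Let $$f_0=\sum_{(k_1,\dots,k_d)} x^{(1)}_{(k_1,k_2)}x^{(2)}_{(k_2,k_3)}\cdots x^{(d)}_{(k_d,k_1)},$$ where the sum is over all $(k_1,\dots,k_d)\in[w_1]\times\cdots\times[w_d]$ such that, with $k_{d+1}:=k_1$, exactly one $i\in\{1,\dots,d\}$ satisfies $k_i\equiv k_{i+1}\pmod 2$. Then: 1. every $f'_\varepsilon$ ($\varepsilon\in\mathbb{C}$) and every $f_\varepsilon$ ($\varepsilon\neq 0$) is computed by a trace ABP of format $w$, and $f_0=\lim_{\varepsilon\to0}f_\varepsilon$ coefficientwise; 2. $f_0$ is not computed by any trace ABP of format $w$; 3. consequently, if $w_1=\cdots=w_d=m$, then $\underline{\mathsf{ncw}}(f_0)=m<\mathsf{ncw}(f_0)$. -/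

import Mathlib

open Filter Topology

/-- Noncommutative polynomials over `ℂ` in the variables `X`. -/
abbrev NCPoly (X : Type) : Type := FreeAlgebra ℂ X

/-- The coefficient of the noncommutative monomial `m` (a word in the variables) in `f`. -/
noncomputable def NCPoly.coeff {X : Type} (f : NCPoly X) (m : FreeMonoid X) : ℂ :=
  (FreeAlgebra.equivMonoidAlgebraFreeMonoid f).coeff m

/-- Coefficientwise convergence of noncommutative polynomials. -/
def CoeffTendsto {X ι : Type} (g : ι → NCPoly X) (l : Filter ι) (f : NCPoly X) : Prop :=
  ∀ m : FreeMonoid X, Tendsto (fun t => NCPoly.coeff (g t) m) l (𝓝 (NCPoly.coeff f m))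

/-- Homogeneous linear forms: linear combinations of the variables. -/
def IsLinearForm {X : Type} (f : NCPoly X) : Prop :=
  f ∈ Submodule.span ℂ (Set.range (FreeAlgebra.ι ℂ : X → NCPoly X))

/-- Edge labels of a trace ABP with `d` layers of edges and format `w = (w 0, …, w (d-1))`.
Addition in `Fin d` is cyclic, so layer `d` (the last one) has `w 0` vertices, and the `j`-th vertex
of the last layer is the one corresponding to the `j`-th vertex of the first layer.
Absent edges carry the label `0`. -/
abbrev ABPLabels {d : ℕ} [NeZero d] (w : Fin d → ℕ) (X : Type) : Type :=
  ∀ i : Fin d, Fin (w i) → Fin (w (i + 1)) → NCPoly X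

/-- The sum, over all paths from a vertex of the first layer to the corresponding vertex of the last
layer, of the ordered product of the labels of the path's edges. -/
noncomputable def abpValue {d : ℕ} [NeZero d] {w : Fin d → ℕ} {X : Type}
    (M : ABPLabels w X) : NCPoly X :=
  ∑ k : (∀ i : Fin d, Fin (w i)), (List.ofFn fun i : Fin d => M i (k i) (k (i + 1))).prod

/-- `f` is computed by a (homogeneous, noncommutative) trace ABP of format `w`. -/
def ComputedByFormat {d : ℕ} [NeZero d] (w : Fin d → ℕ) {X : Type} (f : NCPoly X) : Prop :=
  ∃ M : ABPLabels w X, (∀ i a b, IsLinearForm (M i a b)) ∧ abpValue M = f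

/-- `f` is computed by a trace ABP with `d` layers of edges and with at most `m` vertices in every
layer. -/
def ComputedByWidth (d : ℕ) [NeZero d] (m : ℕ) {X : Type} (f : NCPoly X) : Prop :=
  ∃ w : Fin d → ℕ, (∀ i, w i ≤ m) ∧ ComputedByFormat w f

/-- The noncommutative trace ABP width complexity of a homogeneous polynomial `f` of degree `d`. -/
noncomputable def ncWidth (d : ℕ) [NeZero d] {X : Type} (f : NCPoly X) : ℕ :=
  sInf {m : ℕ | ComputedByWidth d m f}

/-- The noncommutative border trace ABP width complexity of a homogeneous polynomial `f` of
degree `d`. -/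
noncomputable def borderNcWidth (d : ℕ) [NeZero d] {X : Type} (f : NCPoly X) : ℕ :=
  sInf {m : ℕ | ∃ g : ℕ → NCPoly X, (∀ n, ComputedByWidth d m (g n)) ∧ CoeffTendsto g atTop f}

/-- The variables `x^(i)_(a,b)`, one for every edge of the complete ABP of format `w`. -/
abbrev EdgeVar {d : ℕ} [NeZero d] (w : Fin d → ℕ) : Type :=
  Σ i : Fin d, Fin (w i) × Fin (w (i + 1))

/-- The variable `x^(i)_(a,b)` as a noncommutative polynomial. -/
noncomputable def edgeX {d : ℕ} [NeZero d] (w : Fin d → ℕ) (i : Fin d) (a : Fin (w i))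
    (b : Fin (w (i + 1))) : NCPoly (EdgeVar w) :=
  FreeAlgebra.ι ℂ (⟨i, a, b⟩ : EdgeVar w)

/-- An edge from the `a`-th to the `b`-th vertex is parity preserving if `a ≡ b (mod 2)`. -/
abbrev ParityPreserving {m n : ℕ} (a : Fin m) (b : Fin n) : Prop :=
  (a : ℕ) % 2 = (b : ℕ) % 2

/-- The polynomial `f'_ε`: parity preserving edges are labelled `ε x^(i)_(a,b)`, parity changing
edges are labelled `x^(i)_(a,b)`. -/
noncomputable def fEpsPrime {d : ℕ} [NeZero d] (w : Fin d → ℕ) (ε : ℂ) : NCPoly (EdgeVar w) :=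
  abpValue (w := w) fun i a b =>
    if ParityPreserving a b then ε • edgeX w i a b else edgeX w i a b

/-- The polynomial `f_ε = (1/ε) f'_ε` (meaningful for `ε ≠ 0`). -/
noncomputable def fEps {d : ℕ} [NeZero d] (w : Fin d → ℕ) (ε : ℂ) : NCPoly (EdgeVar w) :=
  ε⁻¹ • fEpsPrime w ε

/-- The polynomial `f_0`: the sum of the monomials of all paths between corresponding vertices that
use exactly one parity preserving edge. -/
noncomputable def fZero {d : ℕ} [NeZero d] (w : Fin d → ℕ) : NCPoly (EdgeVar w) :=
  ∑ k : (∀ i : Fin d, Fin (w i)) with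
      (Finset.univ.filter fun i : Fin d => ParityPreserving (k i) (k (i + 1))).card = 1,
    (List.ofFn fun i : Fin d => edgeX w i (k i) (k (i + 1))).prod

/-! The vertex parities cancel around a closed path, so for odd `d` the number of parity preserving
edges is odd, in particular at least one. Hence `f'_ε` is divisible by `ε`, and after division only
the paths with exactly one such edge survive as `ε → 0`.

For the lower bound, an ABP of format `w` for `f_0` gives linear maps `A i` on matrices such that
the form of `f_0` at `X` is the trace of the product of the `A i (X i)` (`pathForm_goodPaths_eq`).
Every edge lies on a path of `f_0`, so each `A i` is bijective (`layerMap_injective`). Put the unit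
`E` of the parity preserving edge `0 → 0` in layer `i` and `Z` in layer `i + 1`. A path of `f_0`
through that edge must next change parity, so the form sees only the entries `Z 0 c` with `c` odd.
As the other arguments are arbitrary, `A i E * A (i + 1) Z` depends only on these entries. But a row
of it at which `A i E` is nonzero takes all values in a space of dimension `w (i + 2)`, which
exceeds the number of odd `c` (`not_exists_layerMap`).

For constant format `m`, the border width is at least `m` because a flattening of `f_0` along one
layer has rank `m ^ 2`, and rank bounds survive limits. -/

/-! ### Coefficients of products of linear forms. -/

section Coefficients

variable {X : Type}

/-- The coefficient of a fixed word, as a linear functional. -/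
noncomputable def NCPoly.coeffLinear (m : FreeMonoid X) : NCPoly X →ₗ[ℂ] ℂ where
  toFun f := NCPoly.coeff f m
  map_add' f g := by simp [NCPoly.coeff]
  map_smul' c f := by simp [NCPoly.coeff]

theorem NCPoly.coeff_sum {ι : Type*} (s : Finset ι) (f : ι → NCPoly X) (m : FreeMonoid X) :
    NCPoly.coeff (∑ i ∈ s, f i) m = ∑ i ∈ s, NCPoly.coeff (f i) m :=
  map_sum (NCPoly.coeffLinear m) f s

theorem NCPoly.coeff_smul (c : ℂ) (f : NCPoly X) (m : FreeMonoid X) :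
    NCPoly.coeff (c • f) m = c * NCPoly.coeff f m :=
  (NCPoly.coeffLinear m).map_smul c f

theorem NCPoly.coeff_zero (m : FreeMonoid X) : NCPoly.coeff (0 : NCPoly X) m = 0 :=
  (NCPoly.coeffLinear m).map_zero

theorem NCPoly.coeff_one_one : NCPoly.coeff (1 : NCPoly X) 1 = 1 := by
  simp [NCPoly.coeff]

theorem equivMonoidAlgebraFreeMonoid_ι (x : X) :
    FreeAlgebra.equivMonoidAlgebraFreeMonoid (FreeAlgebra.ι ℂ x) =
      MonoidAlgebra.single (FreeMonoid.of x) (1 : ℂ) := by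
  simp [FreeAlgebra.equivMonoidAlgebraFreeMonoid]

theorem NCPoly.coeff_ι [DecidableEq X] (x y : X) :
    NCPoly.coeff (FreeAlgebra.ι ℂ x) (FreeMonoid.of y) = if y = x then 1 else 0 := by
  classical
  rw [NCPoly.coeff, equivMonoidAlgebraFreeMonoid_ι, MonoidAlgebra.coeff_single,
    Finsupp.single_apply]
  simp [FreeMonoid.of_injective.eq_iff, eq_comm]

/-- The first letter of a word is read off by the first linear factor. -/
theorem IsLinearForm.coeff_mul {f : NCPoly X} (hf : IsLinearForm f) (g : NCPoly X) (x : X)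
    (m : FreeMonoid X) :
    NCPoly.coeff (f * g) (FreeMonoid.of x * m) =
      NCPoly.coeff f (FreeMonoid.of x) * NCPoly.coeff g m := by
  classical
  induction hf using Submodule.span_induction with
  | mem f hf =>
    obtain ⟨y, rfl⟩ := hf
    rw [NCPoly.coeff_ι]
    simp only [NCPoly.coeff, map_mul, equivMonoidAlgebraFreeMonoid_ι]
    split_ifs with h
    · subst h
      rw [MonoidAlgebra.coeff_single_mul_eq_mul_coeff m (fun m' _ => mul_right_inj _)]
    · rw [MonoidAlgebra.coeff_single_mul_of_forall_mul_ne, zero_mul]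
      intro m' h'
      exact h (List.cons.inj h').1.symm
  | zero => simp [NCPoly.coeff_zero]
  | add f₁ f₂ _ _ h₁ h₂ =>
    have e := (NCPoly.coeffLinear (FreeMonoid.of x * m)).map_add (f₁ * g) (f₂ * g)
    have e' := (NCPoly.coeffLinear (FreeMonoid.of x)).map_add f₁ f₂
    change NCPoly.coeff _ _ = NCPoly.coeff _ _ + NCPoly.coeff _ _ at e e'
    rw [add_mul, e, e', h₁, h₂, add_mul]
  | smul c f _ h => rw [smul_mul_assoc, NCPoly.coeff_smul, NCPoly.coeff_smul, h, mul_assoc]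

theorem NCPoly.coeff_prod_linear {d : ℕ} (l : Fin d → NCPoly X) (hl : ∀ i, IsLinearForm (l i))
    (v : Fin d → X) :
    NCPoly.coeff (List.ofFn l).prod (List.ofFn fun i => FreeMonoid.of (v i)).prod =
      ∏ i, NCPoly.coeff (l i) (FreeMonoid.of (v i)) := by
  induction d with
  | zero => simp [NCPoly.coeff_one_one]
  | succ d ih =>
    rw [List.ofFn_succ, List.ofFn_succ, List.prod_cons, List.prod_cons, (hl 0).coeff_mul,
      ih _ fun i => hl _, Fin.prod_univ_succ]

theorem List.prod_ofFn_smul {R A : Type*} [CommSemiring R] [Semiring A] [Algebra R A] {d : ℕ}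
    (c : Fin d → R) (y : Fin d → A) :
    (List.ofFn fun i => c i • y i).prod = (∏ i, c i) • (List.ofFn y).prod := by
  induction d with
  | zero => simp
  | succ d ih =>
    rw [List.ofFn_succ, List.prod_cons, ih, Fin.prod_univ_succ, List.ofFn_succ, List.prod_cons,
      smul_mul_smul_comm]

theorem IsLinearForm.smul {f : NCPoly X} (hf : IsLinearForm f) (c : ℂ) : IsLinearForm (c • f) :=
  Submodule.smul_mem _ c hf

theorem IsLinearForm.zero : IsLinearForm (0 : NCPoly X) := Submodule.zero_mem _

theorem isLinearForm_edgeX {d : ℕ} [NeZero d] (w : Fin d → ℕ) (i : Fin d) (a : Fin (w i))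
    (b : Fin (w (i + 1))) : IsLinearForm (edgeX w i a b) :=
  Submodule.subset_span ⟨_, rfl⟩

theorem coeff_abpValue {d : ℕ} [NeZero d] {w : Fin d → ℕ} {M : ABPLabels w X}
    (hM : ∀ i a b, IsLinearForm (M i a b)) (v : Fin d → X) :
    NCPoly.coeff (abpValue M) (List.ofFn fun i => FreeMonoid.of (v i)).prod =
      ∑ k : (∀ i, Fin (w i)), ∏ i, NCPoly.coeff (M i (k i) (k (i + 1))) (FreeMonoid.of (v i)) := by
  rw [abpValue, NCPoly.coeff_sum]
  exact Finset.sum_congr rfl fun k _ => NCPoly.coeff_prod_linear _ (fun i => hM i _ _) v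

theorem coeff_fZero {d : ℕ} [NeZero d] (w : Fin d → ℕ) (v : Fin d → EdgeVar w) :
    NCPoly.coeff (fZero w) (List.ofFn fun i => FreeMonoid.of (v i)).prod =
      ∑ k : (∀ i : Fin d, Fin (w i)) with
        (Finset.univ.filter fun i : Fin d => ParityPreserving (k i) (k (i + 1))).card = 1,
        ∏ i, if v i = ⟨i, k i, k (i + 1)⟩ then 1 else 0 := by
  rw [fZero, NCPoly.coeff_sum]
  refine Finset.sum_congr rfl fun k _ => ?_
  rw [NCPoly.coeff_prod_linear _ (fun i => isLinearForm_edgeX w i _ _)]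
  simp only [edgeX, NCPoly.coeff_ι]

end Coefficients

/-! ### The degeneration of `f_ε` to `f_0`. -/

section Limit

variable {d : ℕ} [NeZero d] (w : Fin d → ℕ)

/-- The number of parity preserving edges of a closed path. -/
def numPreserving {w : Fin d → ℕ} (k : ∀ i : Fin d, Fin (w i)) : ℕ :=
  (Finset.univ.filter fun i : Fin d => ParityPreserving (k i) (k (i + 1))).card

/-- A closed path of odd length has an odd number of parity preserving edges. -/
theorem odd_numPreserving (hodd : Odd d) {w : Fin d → ℕ} (k : ∀ i : Fin d, Fin (w i)) :
    Odd (numPreserving k) := by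
  -- Modulo 2, `a + b + 1` is the indicator of a parity preserving edge; each vertex is counted
  -- twice around the cycle, which leaves `d`.
  have h1 : ∑ i : Fin d, ((k i : ℕ) + (k (i + 1) : ℕ) + 1 : ZMod 2) =
      ((numPreserving k : ℕ) : ZMod 2) := by
    rw [numPreserving, Finset.card_filter, Nat.cast_sum]
    refine Finset.sum_congr rfl fun i _ => ?_
    have key : ∀ a b : ℕ,
        ((a : ZMod 2) + b + 1) = ((if a % 2 = b % 2 then 1 else 0 : ℕ) : ZMod 2) := by
      intro a b
      rw [← Nat.cast_one, ← Nat.cast_add, ← Nat.cast_add, ZMod.natCast_eq_natCast_iff']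
      split_ifs <;> omega
    simpa using key (k i) (k (i + 1))
  have h2 : ∑ i : Fin d, ((k (i + 1) : ℕ) : ZMod 2) = ∑ i : Fin d, ((k i : ℕ) : ZMod 2) :=
    Equiv.sum_comp (Equiv.addRight (1 : Fin d)) fun i => ((k i : ℕ) : ZMod 2)
  rw [Finset.sum_add_distrib, Finset.sum_add_distrib, h2, CharTwo.add_self_eq_zero, zero_add] at h1
  rw [← ZMod.natCast_eq_one_iff_odd, ← h1]
  simpa [ZMod.natCast_eq_one_iff_odd] using hodd

theorem fEpsPrime_eq_sum (ε : ℂ) :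
    fEpsPrime w ε = ∑ k : (∀ i : Fin d, Fin (w i)),
      ε ^ numPreserving k • (List.ofFn fun i : Fin d => edgeX w i (k i) (k (i + 1))).prod := by
  refine Finset.sum_congr rfl fun k _ => ?_
  rw [numPreserving, Finset.card_filter, ← Finset.prod_pow_eq_pow_sum, ← List.prod_ofFn_smul]
  congr 2
  funext i
  beta_reduce
  by_cases h : ParityPreserving (k i) (k (i + 1))
  · rw [if_pos h, if_pos h, pow_one]
  · rw [if_neg h, if_neg h, pow_zero, one_smul]

theorem computedByFormat_fEpsPrime (ε : ℂ) : ComputedByFormat w (fEpsPrime w ε) := by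
  refine ⟨_, fun i a b => ?_, rfl⟩
  split_ifs
  · exact (isLinearForm_edgeX w i a b).smul ε
  · exact isLinearForm_edgeX w i a b

theorem ComputedByFormat.smul {X : Type} {w : Fin d → ℕ} {f : NCPoly X}
    (hf : ComputedByFormat w f) (c : ℂ) : ComputedByFormat w (c • f) := by
  obtain ⟨M, hM, rfl⟩ := hf
  refine ⟨fun i a b => (if i = 0 then c else 1) • M i a b, fun i a b => (hM i a b).smul _, ?_⟩
  rw [abpValue, abpValue, Finset.smul_sum]
  refine Finset.sum_congr rfl fun k _ => ?_
  rw [List.prod_ofFn_smul, Finset.prod_ite_eq' Finset.univ (0 : Fin d) fun _ => c]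
  simp

theorem computedByFormat_fEps (ε : ℂ) : ComputedByFormat w (fEps w ε) :=
  (computedByFormat_fEpsPrime w ε).smul _

theorem tendsto_fEps (hodd : Odd d) :
    CoeffTendsto (fun ε : ℂ => fEps w ε) (𝓝[≠] 0) (fZero w) := by
  intro m
  -- The truncated exponent is honest since `numPreserving k` is odd; `0 ^ 0 = 1` selects the paths
  -- of `f_0`.
  have h0 : NCPoly.coeff (fZero w) m = ∑ k : (∀ i : Fin d, Fin (w i)),
      (0 : ℂ) ^ (numPreserving k - 1) *
        NCPoly.coeff (List.ofFn fun i : Fin d => edgeX w i (k i) (k (i + 1))).prod m := by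
    rw [fZero, NCPoly.coeff_sum, Finset.sum_filter]
    refine Finset.sum_congr rfl fun k _ => ?_
    obtain ⟨r, hr⟩ := odd_numPreserving hodd k
    change (if numPreserving k = 1 then _ else _) = _
    rcases Nat.eq_zero_or_pos r with rfl | hr0
    · simp [hr]
    · rw [if_neg (by omega), zero_pow (by omega), zero_mul]
  have hc : Continuous fun ε : ℂ => ∑ k : (∀ i : Fin d, Fin (w i)),
      ε ^ (numPreserving k - 1) *
        NCPoly.coeff (List.ofFn fun i : Fin d => edgeX w i (k i) (k (i + 1))).prod m := by
    fun_prop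
  rw [h0]
  refine ((hc.tendsto 0).mono_left nhdsWithin_le_nhds).congr' ?_
  filter_upwards [self_mem_nhdsWithin] with ε hε
  rw [fEps, NCPoly.coeff_smul, fEpsPrime_eq_sum, NCPoly.coeff_sum, Finset.mul_sum]
  refine Finset.sum_congr rfl fun k _ => ?_
  obtain ⟨r, hr⟩ := odd_numPreserving hodd k
  have hε' : ε ≠ 0 := hε
  rw [NCPoly.coeff_smul, hr, ← mul_assoc, Nat.add_sub_cancel, pow_succ', inv_mul_cancel_left₀ hε']

end Limit

/-! ### Closed paths with prescribed parities. -/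

section Paths

variable {d : ℕ} [NeZero d] {w : Fin d → ℕ}

theorem Fin.val_add_one_cyclic (t : Fin d) :
    ((t + 1 : Fin d) : ℕ) = if (t : ℕ) + 1 = d then 0 else (t : ℕ) + 1 := by
  have ht := t.isLt
  rw [Fin.val_add, Fin.val_one', Nat.add_mod_mod]
  split_ifs with h
  · rw [h, Nat.mod_self]
  · exact Nat.mod_eq_of_lt (by omega)

theorem Fin.add_one_ne_self (hd : 2 ≤ d) (i : Fin d) : i + 1 ≠ i := by
  intro h
  have := Fin.val_add_one_cyclic i
  rw [h] at this
  split_ifs at this <;> omega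

theorem Fin.add_one_add_one_ne_self (hd : 3 ≤ d) (i : Fin d) : i + 1 + 1 ≠ i := by
  intro h
  have h1 := Fin.val_add_one_cyclic i
  have h2 := Fin.val_add_one_cyclic (i + 1)
  rw [h] at h2
  have := i.isLt
  split_ifs at h1 h2 <;> omega

/-- Paths with prescribed parities and prescribed first edge. -/
theorem exists_path_of_parity (hd : 2 ≤ d) (hw : ∀ i, 2 ≤ w i) (i : Fin d) (a : Fin (w i))
    (b : Fin (w (i + 1))) (π : Fin d → ℕ) (ha : π i % 2 = (a : ℕ) % 2)
    (hb : π (i + 1) % 2 = (b : ℕ) % 2) :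
    ∃ k : ∀ j, Fin (w j), k i = a ∧ k (i + 1) = b ∧ ∀ j, (k j : ℕ) % 2 = π j % 2 := by
  let k₀ : ∀ j, Fin (w j) := fun j => ⟨π j % 2, (Nat.mod_lt _ two_pos).trans_le (hw j)⟩
  have hi := Fin.add_one_ne_self hd i
  refine ⟨Function.update (Function.update k₀ i a) (i + 1) b, ?_, ?_, fun j => ?_⟩
  · rw [Function.update_of_ne hi.symm, Function.update_self]
  · rw [Function.update_self]
  · by_cases h1 : j = i + 1
    · subst h1
      rw [Function.update_self, hb]
    · by_cases h2 : j = i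
      · subst h2
        rw [Function.update_of_ne h1, Function.update_self, ha]
      · rw [Function.update_of_ne h1, Function.update_of_ne h2]
        exact Nat.mod_mod _ _

/-- Every edge lies on a closed path with exactly one parity preserving edge. -/
theorem exists_numPreserving_eq_one (hd : 2 ≤ d) (hodd : Odd d) (hw : ∀ i, 2 ≤ w i) (i : Fin d)
    (a : Fin (w i)) (b : Fin (w (i + 1))) :
    ∃ k : ∀ j, Fin (w j), k i = a ∧ k (i + 1) = b ∧ numPreserving k = 1 := by
  have hsub : ∀ j, j + 1 - i = j - i + 1 := fun j => by abel
  have h1 : ((i + 1 - i : Fin d) : ℕ) = 1 := by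
    rw [hsub, Fin.val_add_one_cyclic, sub_self, Fin.val_zero, if_neg (by omega)]
  obtain ⟨r, hr⟩ := hodd
  by_cases hab : ParityPreserving a b
  -- The parity is kept along edge `i` and alternates afterwards; since `d` is odd, the closing edge
  -- into layer `i` also changes parity.
  · obtain ⟨k, hka, hkb, hk⟩ := exists_path_of_parity hd hw i a b
      (fun j => if j = i then a else (a : ℕ) + ((j - i : Fin d) : ℕ) + 1) (by simp)
      (by rw [if_neg (Fin.add_one_ne_self hd i), h1, ← hab]; omega)
    refine ⟨k, hka, hkb, Finset.card_eq_one.2 ⟨i, ?_⟩⟩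
    ext j
    have e := Fin.val_add_one_cyclic (j - i)
    rw [← hsub] at e
    have hj : j - i = 0 ↔ j = i := sub_eq_zero
    have hj' : j + 1 - i = 0 ↔ j + 1 = i := sub_eq_zero
    rw [← Fin.val_eq_zero_iff] at hj hj'
    have hlt := (j - i).isLt
    rw [Finset.mem_filter_univ, Finset.mem_singleton, ParityPreserving, hk, hk]
    simp only [← hj, ← hj']
    split_ifs at e ⊢ <;> omega
  -- Parities alternate from layer `i` on; since `d` is odd, exactly the closing edge `i - 1`
  -- preserves parity.
  · obtain ⟨k, hka, hkb, hk⟩ := exists_path_of_parity hd hw i a b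
      (fun j => (a : ℕ) + ((j - i : Fin d) : ℕ)) (by simp)
      (by rw [h1]; unfold ParityPreserving at hab; omega)
    refine ⟨k, hka, hkb, Finset.card_eq_one.2 ⟨i - 1, ?_⟩⟩
    ext j
    have e := Fin.val_add_one_cyclic (j - i)
    rw [← hsub] at e
    have hj' : j + 1 - i = 0 ↔ j = i - 1 := by rw [sub_eq_zero, eq_sub_iff_add_eq]
    rw [← Fin.val_eq_zero_iff] at hj'
    have hlt := (j - i).isLt
    rw [Finset.mem_filter_univ, Finset.mem_singleton, ParityPreserving, hk, hk, ← hj']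
    split_ifs at e <;> omega

end Paths

/-! ### Evaluating path forms on matrix units. -/

section MultilinearForm

variable {d : ℕ} [NeZero d] {w : Fin d → ℕ}

/-- The multilinear form of a set of closed paths, on tuples of matrices. -/
noncomputable def pathForm (S : Finset (∀ i : Fin d, Fin (w i)))
    (X : ∀ i : Fin d, Matrix (Fin (w i)) (Fin (w (i + 1))) ℂ) : ℂ :=
  ∑ k ∈ S, ∏ i, X i (k i) (k (i + 1))

/-- The matrix unit of the `i`-th edge of a path. -/
noncomputable def edgeUnit (k : ∀ i : Fin d, Fin (w i)) (i : Fin d) :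
    Matrix (Fin (w i)) (Fin (w (i + 1))) ℂ :=
  Matrix.single (k i) (k (i + 1)) 1

theorem edgeUnit_self (k : ∀ i : Fin d, Fin (w i)) (i : Fin d) :
    edgeUnit k i (k i) (k (i + 1)) = 1 := Matrix.single_apply_same ..

theorem eq_of_edgeUnit_ne_zero {k k' : ∀ i : Fin d, Fin (w i)} {i : Fin d}
    (h : edgeUnit k i (k' i) (k' (i + 1)) ≠ 0) : k' i = k i ∧ k' (i + 1) = k (i + 1) := by
  by_contra hne
  refine h (Matrix.single_apply_of_ne _ _ _ _ _ fun h' => hne ⟨h'.1.symm, h'.2.symm⟩)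

/-- The multilinear form isolates the entry of its `i`-th argument at an edge of a path. -/
theorem pathForm_eq_entry (hd : 2 ≤ d) (S : Finset (∀ i : Fin d, Fin (w i)))
    {k : ∀ i : Fin d, Fin (w i)} (hk : k ∈ S) (i : Fin d)
    {X : ∀ i : Fin d, Matrix (Fin (w i)) (Fin (w (i + 1))) ℂ}
    (hX : ∀ j, j ≠ i → X j = edgeUnit k j) :
    pathForm S X = X i (k i) (k (i + 1)) := by
  rw [pathForm, Finset.sum_eq_single k, Finset.prod_eq_single i]
  · intro j _ hj
    rw [hX j hj, edgeUnit_self]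
  · simp
  · intro k' _ hne
    by_contra h
    have h' := Finset.prod_ne_zero_iff.1 h
    refine hne (funext fun j => ?_)
    by_cases hj : j = i
    · subst hj
      -- The argument at `i` is free, so the vertex in layer `i` is recovered as the endpoint of the
      -- preceding edge.
      obtain ⟨l, rfl⟩ : ∃ l, l + 1 = j := ⟨j - 1, sub_add_cancel j 1⟩
      have hl := (Fin.add_one_ne_self hd l).symm
      exact (eq_of_edgeUnit_ne_zero (hX l hl ▸ h' l (Finset.mem_univ l))).2
    · exact (eq_of_edgeUnit_ne_zero (hX j hj ▸ h' j (Finset.mem_univ j))).1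
  · exact fun h => (h hk).elim

/-- The trace form isolates the entries of a product of two consecutive arguments. -/
theorem pathForm_univ_eq_mul_entry (hd : 3 ≤ d) (k : ∀ i : Fin d, Fin (w i)) (i : Fin d)
    {X : ∀ i : Fin d, Matrix (Fin (w i)) (Fin (w (i + 1))) ℂ}
    (hX : ∀ j, j ≠ i → j ≠ i + 1 → X j = edgeUnit k j) :
    pathForm Finset.univ X = (X i * X (i + 1)) (k i) (k (i + 1 + 1)) := by
  have h1 := Fin.add_one_ne_self (by omega) i
  have h2 := Fin.add_one_add_one_ne_self hd i
  have h3 := Fin.add_one_ne_self (by omega) (i + 1)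
  rw [pathForm, Matrix.mul_apply]
  symm
  -- Only paths agreeing with `k` off layer `i + 1` contribute, so the sum runs over that one
  -- vertex, as in a matrix product.
  refine Fintype.sum_of_injective (fun b => Function.update k (i + 1) b)
    (Function.update_injective k (i + 1)) _ _ (fun k' hk' => ?_) fun b => ?_
  · by_contra h
    have h' := Finset.prod_ne_zero_iff.1 h
    refine hk' ⟨k' (i + 1), funext fun j => ?_⟩
    by_cases hj : j = i + 1
    · subst hj
      simp
    · refine (Function.update_of_ne hj _ _).trans (Eq.symm ?_)
      by_cases hji : j = i
      · subst hji
        obtain ⟨l, rfl⟩ : ∃ l, l + 1 = j := ⟨j - 1, sub_add_cancel j 1⟩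
        have hl := (Fin.add_one_ne_self (by omega) l).symm
        have hl' := (Fin.add_one_add_one_ne_self hd l).symm
        exact (eq_of_edgeUnit_ne_zero (hX l hl hl' ▸ h' l (Finset.mem_univ l))).2
      · exact (eq_of_edgeUnit_ne_zero (hX j hji hj ▸ h' j (Finset.mem_univ j))).1
  · rw [Finset.prod_eq_mul i (i + 1) h1.symm]
    · rw [Function.update_self, Function.update_of_ne h1.symm, Function.update_of_ne h3]
    · intro j _ hj
      rw [hX j hj.1 hj.2]
      have hj' : j + 1 ≠ i + 1 := fun h => hj.1 (add_right_cancel h)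
      rw [Function.update_of_ne hj.2, Function.update_of_ne hj', edgeUnit_self]
    · simp
    · simp

end MultilinearForm

/-! ### No ABP of format `w` computes `f_0`. -/

section NoABP

variable {d : ℕ} [NeZero d] {w : Fin d → ℕ}

/-- The closed paths with exactly one parity preserving edge. -/
def goodPaths (w : Fin d → ℕ) : Finset (∀ i : Fin d, Fin (w i)) :=
  Finset.univ.filter fun k => numPreserving k = 1

theorem mem_goodPaths {k : ∀ i : Fin d, Fin (w i)} : k ∈ goodPaths w ↔ numPreserving k = 1 :=
  Finset.mem_filter_univ k

/-- The action of the labels of a layer on the matrices of variables of that layer. -/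
noncomputable def layerMap (M : ABPLabels w (EdgeVar w)) (i : Fin d) :
    Matrix (Fin (w i)) (Fin (w (i + 1))) ℂ →ₗ[ℂ] Matrix (Fin (w i)) (Fin (w (i + 1))) ℂ where
  toFun X := Matrix.of fun a b =>
    ∑ p : Fin (w i) × Fin (w (i + 1)), X p.1 p.2 * NCPoly.coeff (M i a b) (FreeMonoid.of ⟨i, p⟩)
  map_add' X Y := by
    ext a b
    simp [add_mul, Finset.sum_add_distrib]
  map_smul' c X := by
    ext a b
    simp [mul_assoc, Finset.mul_sum]

/-- Only words whose `i`-th letter is a variable of layer `i` are compared; weighting their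
coefficients by the entries of `X` and summing gives both forms. -/
theorem pathForm_goodPaths_eq {M : ABPLabels w (EdgeVar w)}
    (hM : ∀ i a b, IsLinearForm (M i a b)) (h : abpValue M = fZero w)
    (X : ∀ i : Fin d, Matrix (Fin (w i)) (Fin (w (i + 1))) ℂ) :
    pathForm (goodPaths w) X = pathForm Finset.univ fun i => layerMap M i (X i) := by
  have hcoeff (p : ∀ i : Fin d, Fin (w i) × Fin (w (i + 1))) :
      (∑ k ∈ goodPaths w, ∏ i, if p i = (k i, k (i + 1)) then (1 : ℂ) else 0) =
      ∑ k : (∀ i, Fin (w i)), ∏ i, NCPoly.coeff (M i (k i) (k (i + 1))) (FreeMonoid.of ⟨i, p i⟩) := by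
    rw [← coeff_abpValue hM fun i => ⟨i, p i⟩, h, coeff_fZero]
    refine Finset.sum_congr rfl fun k _ => Finset.prod_congr rfl fun i _ => ?_
    simp
  have hl (k : ∀ i : Fin d, Fin (w i)) : ∏ i, X i (k i) (k (i + 1)) =
      ∑ p : (∀ i : Fin d, Fin (w i) × Fin (w (i + 1))), (∏ i, X i (p i).1 (p i).2) *
        ∏ i, if p i = (k i, k (i + 1)) then (1 : ℂ) else 0 := by
    simp_rw [← Finset.prod_mul_distrib]
    rw [← Fintype.piFinset_univ, ← Finset.prod_univ_sum (fun _ => Finset.univ)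
      fun i (p : Fin (w i) × Fin (w (i + 1))) =>
        X i p.1 p.2 * if p = (k i, k (i + 1)) then (1 : ℂ) else 0]
    simp
  have hr (k : ∀ i : Fin d, Fin (w i)) : ∏ i, layerMap M i (X i) (k i) (k (i + 1)) =
      ∑ p : (∀ i : Fin d, Fin (w i) × Fin (w (i + 1))), (∏ i, X i (p i).1 (p i).2) *
        ∏ i, NCPoly.coeff (M i (k i) (k (i + 1))) (FreeMonoid.of ⟨i, p i⟩) := by
    simp_rw [← Finset.prod_mul_distrib]
    rw [← Fintype.piFinset_univ, ← Finset.prod_univ_sum (fun _ => Finset.univ)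
      fun i (p : Fin (w i) × Fin (w (i + 1))) =>
        X i p.1 p.2 * NCPoly.coeff (M i (k i) (k (i + 1))) (FreeMonoid.of ⟨i, p⟩)]
    rfl
  simp_rw [pathForm, hl, hr]
  refine (Finset.sum_comm.trans (Finset.sum_congr rfl fun p _ => ?_)).trans Finset.sum_comm
  rw [← Finset.mul_sum, ← Finset.mul_sum, hcoeff]

/-- The polynomial `f_0` is concise: no layer of an ABP of its own format loses information. -/
theorem layerMap_injective (hd : 2 ≤ d) (hodd : Odd d) (hw : ∀ i, 2 ≤ w i)
    {A : ∀ i : Fin d,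
      Matrix (Fin (w i)) (Fin (w (i + 1))) ℂ →ₗ[ℂ] Matrix (Fin (w i)) (Fin (w (i + 1))) ℂ}
    (h : ∀ X, pathForm (goodPaths w) X = pathForm Finset.univ fun i => A i (X i)) (i : Fin d) :
    Function.Injective (A i) := by
  rw [injective_iff_map_eq_zero]
  intro Z hZ
  ext a b
  -- With units of a good path in all other slots, the left form reads off `Z a b`, while the right
  -- form vanishes because `A i Z = 0`.
  obtain ⟨k, rfl, rfl, hk⟩ := exists_numPreserving_eq_one hd hodd hw i a b
  have e := pathForm_eq_entry hd _ (mem_goodPaths.2 hk) i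
    (X := Function.update (edgeUnit k) i Z) fun j hj => Function.update_of_ne hj _ _
  rw [Function.update_self, h] at e
  rw [← e, Matrix.zero_apply]
  refine Finset.sum_eq_zero fun k' _ => Finset.prod_eq_zero (Finset.mem_univ i) ?_
  simp only [Function.update_self, hZ, Matrix.zero_apply]

theorem not_exists_layerMap (hd : 3 ≤ d) (hodd : Odd d) (hw : ∀ i, 2 ≤ w i)
    (A : ∀ i : Fin d,
      Matrix (Fin (w i)) (Fin (w (i + 1))) ℂ →ₗ[ℂ] Matrix (Fin (w i)) (Fin (w (i + 1))) ℂ) :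
    ¬ ∀ X, pathForm (goodPaths w) X = pathForm Finset.univ fun i => A i (X i) := by
  intro h
  have hinj := layerMap_injective (by omega) hodd hw h
  have hsurj (i) : Function.Surjective (A i) := LinearMap.surjective_of_injective (hinj i)
  obtain ⟨i⟩ : Nonempty (Fin d) := ⟨0⟩
  have hi1 := Fin.add_one_ne_self (by omega) i
  have : NeZero (w i) := ⟨by have := hw i; omega⟩
  have : NeZero (w (i + 1)) := ⟨by have := hw (i + 1); omega⟩
  let E : Matrix (Fin (w i)) (Fin (w (i + 1))) ℂ := Matrix.single 0 0 1
  have hE : A i E ≠ 0 := by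
    rw [Ne, map_eq_zero_iff _ (hinj i)]
    intro h0
    simpa [E] using congrFun (congrFun h0 0) 0
  obtain ⟨a, b, hab⟩ : ∃ a b, A i E a b ≠ 0 := by
    by_contra! h0
    exact hE (Matrix.ext h0)
  -- only the parity changing entries of the first row matter
  have hker (Z : Matrix (Fin (w (i + 1))) (Fin (w (i + 1 + 1))) ℂ)
      (hZ : ∀ c : Fin (w (i + 1 + 1)), (c : ℕ) % 2 = 1 → Z 0 c = 0) :
      A i E * A (i + 1) Z = 0 := by
    ext x c
    -- Any path with `x` and `c` at the ends of the two layers will do. Preimages `R` of its units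
    -- make the trace form read off the `(x, c)` entry of the product.
    let k : ∀ j, Fin (w j) := Function.update (Function.update
      (fun j => ⟨0, two_pos.trans_le (hw j)⟩) i x) (i + 1 + 1) c
    have hkx : k i = x := 
      (Function.update_of_ne (Fin.add_one_add_one_ne_self hd i).symm _ _).trans
        (Function.update_self ..)
    have hkc : k (i + 1 + 1) = c := Function.update_self ..
    choose R hR using fun j => hsurj j (edgeUnit k j)
    let X := Function.update (Function.update R i E) (i + 1) Z
    have hXi : X i = E := 
      (Function.update_of_ne hi1.symm _ _).trans (Function.update_self ..)
    have hXi1 : X (i + 1) = Z := Function.update_self ..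
    have hform := pathForm_univ_eq_mul_entry hd k i (X := fun j => A j (X j)) fun j hj hj' => by
      rw [← hR j]
      simp only [X]
      rw [Function.update_of_ne hj', Function.update_of_ne hj]
    rw [← h, hXi, hXi1, hkx, hkc] at hform
    rw [← hform, Matrix.zero_apply]
    refine Finset.sum_eq_zero fun k' hk' => ?_
    by_contra hne
    have hne' := Finset.prod_ne_zero_iff.1 hne
    have h1 := hne' i (Finset.mem_univ i)
    have h2 := hne' (i + 1) (Finset.mem_univ _)
    rw [hXi] at h1
    rw [hXi1] at h2
    obtain ⟨e0, e1⟩ : 0 = k' i ∧ 0 = k' (i + 1) := by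
      by_contra h0
      exact h1 (Matrix.single_apply_of_ne _ _ _ _ _ h0)
    have hpi : ParityPreserving (k' i) (k' (i + 1)) := by
      rw [ParityPreserving, ← e0, ← e1]; simp
    obtain ⟨l, hl⟩ := Finset.card_eq_one.1 (mem_goodPaths.1 hk')
    have hil : i = l := Finset.mem_singleton.1 (hl ▸ Finset.mem_filter_univ i |>.2 hpi)
    have hnp : ¬ ParityPreserving (k' (i + 1)) (k' (i + 1 + 1)) := fun hp =>
      hi1 ((Finset.mem_singleton.1 (hl ▸ Finset.mem_filter_univ (i + 1) |>.2 hp)).trans hil.symm)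
    rw [ParityPreserving, ← e1] at hnp
    rw [← e1] at h2
    refine h2 (hZ _ ?_)
    simp only [Fin.val_zero] at hnp
    omega
  let O := {c : Fin (w (i + 1 + 1)) // (c : ℕ) % 2 = 1}
  let ext : (O → ℂ) →ₗ[ℂ] Matrix (Fin (w (i + 1))) (Fin (w (i + 1 + 1))) ℂ :=
    { toFun := fun u => Matrix.of fun r c =>
        if hc : r = 0 ∧ (c : ℕ) % 2 = 1 then u ⟨c, hc.2⟩ else 0
      map_add' := fun u v => by
        ext r c
        simp only [Matrix.of_apply, Matrix.add_apply, Pi.add_apply]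
        split_ifs <;> simp
      map_smul' := fun z u => by
        ext r c
        simp only [Matrix.of_apply, Matrix.smul_apply, Pi.smul_apply, RingHom.id_apply]
        split_ifs <;> simp }
  let row : Matrix (Fin (w (i + 1))) (Fin (w (i + 1 + 1))) ℂ →ₗ[ℂ] Fin (w (i + 1 + 1)) → ℂ :=
    { toFun := fun Y => (A i E * Y) a
      map_add' := fun Y Z => by rw [Matrix.mul_add]; rfl
      map_smul' := fun z Y => by rw [Matrix.mul_smul]; rfl }
  have hθ : Function.Surjective (row ∘ₗ A (i + 1) ∘ₗ ext) := by
    intro v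
    -- Scaling `v` by the inverse of the nonzero entry and placing it in row `b` makes row `a` of
    -- the product equal to `v`. By `hker`, `Z` may be replaced by its odd entries in row `0`.
    obtain ⟨Z, hZ⟩ := hsurj (i + 1) (Matrix.of fun r c => if r = b then (A i E a b)⁻¹ * v c else 0)
    refine ⟨fun c => Z 0 c, ?_⟩
    have h0 := hker (Z - ext fun c => Z 0 c) fun c hc => by simp [ext, hc]
    rw [map_sub, Matrix.mul_sub, sub_eq_zero] at h0
    have h1 : row (A (i + 1) (ext fun c => Z 0 c)) = row (A (i + 1) Z) := congrFun h0.symm a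
    rw [LinearMap.comp_apply, LinearMap.comp_apply, h1, hZ]
    funext c
    change (A i E * Matrix.of fun r c => if r = b then (A i E a b)⁻¹ * v c else 0) a c = v c
    simp [Matrix.mul_apply, hab]
  have hrank := LinearMap.finrank_le_finrank_of_surjective hθ
  rw [Module.finrank_fintype_fun_eq_card, Module.finrank_fintype_fun_eq_card] at hrank
  -- Vertex `0` is even, so the odd vertices form a proper subset of the layer.
  refine absurd hrank (not_le.2 (Fintype.card_subtype_lt (x := ⟨0, two_pos.trans_le (hw _)⟩) ?_))
  simp

theorem not_computedByFormat_fZero (hd : 3 ≤ d) (hodd : Odd d) (hw : ∀ i, 2 ≤ w i) :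
    ¬ ComputedByFormat w (fZero w) := by
  rintro ⟨M, hM, h⟩
  exact not_exists_layerMap hd hodd hw (layerMap M) (pathForm_goodPaths_eq hM h)

end NoABP

/-! ### Padding, and the strict lower bound on width. -/

section Width

variable {d : ℕ} [NeZero d]

/-- Unused vertices can be added to every layer. -/
theorem ComputedByFormat.mono {X : Type} {w w' : Fin d → ℕ} (h : ∀ i, w i ≤ w' i)
    {f : NCPoly X} (hf : ComputedByFormat w f) : ComputedByFormat w' f := by
  obtain ⟨M, hM, rfl⟩ := hf
  let M' : ABPLabels w' X := fun i a b =>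
    if hab : (a : ℕ) < w i ∧ (b : ℕ) < w (i + 1) then M i ⟨a, hab.1⟩ ⟨b, hab.2⟩ else 0
  have hM' : ∀ i a b, IsLinearForm (M' i a b) := by
    intro i a b
    simp only [M']
    split_ifs
    · exact hM _ _ _
    · exact IsLinearForm.zero
  refine ⟨M', hM', ?_⟩
  symm
  refine Fintype.sum_of_injective (fun k i => Fin.castLE (h i) (k i)) (fun k k' hk => ?_) _ _
    (fun k hk => ?_) fun k => ?_
  · funext i
    exact Fin.castLE_injective (h i) (congrFun hk i)
  · obtain ⟨i, hi⟩ : ∃ i, ¬ (k i : ℕ) < w i := by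
      by_contra! hlt
      exact hk ⟨fun i => ⟨k i, hlt i⟩, rfl⟩
    refine List.prod_eq_zero ((List.mem_ofFn' _ _).2 ⟨i, ?_⟩)
    exact dif_neg fun hab => hi hab.1
  · congr 2
    funext i
    simp [M']

/-- A sum of `N` products of `d` linear forms has a trace ABP of width `N`. -/
theorem computedByFormat_sum_prod {X : Type} {N : ℕ} (l : Fin N → Fin d → NCPoly X)
    (hl : ∀ n i, IsLinearForm (l n i)) :
    ComputedByFormat (fun _ : Fin d => N) (∑ n, (List.ofFn (l n)).prod) := by
  refine ⟨fun i a b => if a = b then l a i else 0, fun i a b => ?_, ?_⟩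
  · beta_reduce
    split_ifs
    · exact hl a i
    · exact IsLinearForm.zero
  · symm
    refine Fintype.sum_of_injective (fun n _ => n) (fun n n' h => congrFun h 0) _ _
      (fun k hk => ?_) fun n => ?_
    · obtain ⟨i, hi⟩ : ∃ i, k i ≠ k (i + 1) := by
        by_contra! hconst
        refine hk ⟨k 0, funext fun i => ?_⟩
        have : ∀ t : ℕ, k (Fin.ofNat d t) = k 0 := by
          intro t
          induction t with
          | zero => congr 1
          | succ t ih =>
            refine (congrArg k ?_).trans ((hconst (Fin.ofNat d t)).symm.trans ih)
            ext
            simp [Fin.val_add]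
        refine (this i).symm.trans (congrArg k ?_)
        ext
        simp
      refine List.prod_eq_zero ((List.mem_ofFn' _ _).2 ⟨i, ?_⟩)
      exact if_neg hi
    · simp

/-- Needed because `sInf ∅ = 0`: it makes `ncWidth` an attained minimum. -/
theorem exists_computedByWidth_fZero (w : Fin d → ℕ) :
    ∃ m, ComputedByWidth d m (fZero w) := by
  refine ⟨(goodPaths w).card, fun _ => (goodPaths w).card, fun _ => le_rfl, ?_⟩
  convert computedByFormat_sum_prod
    (fun (n : Fin (goodPaths w).card) (i : Fin d) =>
      edgeX w i ((goodPaths w).equivFin.symm n |>.1 i) ((goodPaths w).equivFin.symm n |>.1 (i + 1)))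
    fun n i => isLinearForm_edgeX w i _ _
  rw [(goodPaths w).equivFin.symm.sum_comp fun k =>
    (List.ofFn fun i => edgeX w i (k.1 i) (k.1 (i + 1))).prod]
  rw [Finset.sum_coe_sort (goodPaths w) fun k =>
    (List.ofFn fun i => edgeX w i (k i) (k (i + 1))).prod]
  rfl

theorem lt_ncWidth_fZero (hd : 3 ≤ d) (hodd : Odd d) {w : Fin d → ℕ} (hw : ∀ i, 2 ≤ w i) {m : ℕ}
    (hm : ∀ i, w i = m) : m < ncWidth d (fZero w) := by
  obtain ⟨w', hw', h⟩ := Nat.sInf_mem (s := {m | ComputedByWidth d m (fZero w)})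
    (exists_computedByWidth_fZero w)
  by_contra! hle
  exact not_computedByFormat_fZero hd hodd hw
    (h.mono fun i => (hw' i).trans (hle.trans (hm i).ge))

end Width

/-! ### Flattening ranks and border width. -/

section BorderWidth

variable {d : ℕ} [NeZero d]

/-- A flattening of a trace ABP with respect to one layer has rank at most the number of pairs of
vertices at the two ends of this layer. -/
theorem det_flattening_eq_zero {X ι : Type} [Fintype ι] [DecidableEq ι] {w : Fin d → ℕ}
    {f : NCPoly X} (hf : ComputedByFormat w f) (i : Fin d) (hι : w i * w (i + 1) < Fintype.card ι)
    (u : ι → X) (v : ι → Fin d → X) :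
    (Matrix.of fun p q : ι => NCPoly.coeff f
      (List.ofFn fun j => FreeMonoid.of (Function.update (v q) i (u p) j)).prod).det = 0 := by
  obtain ⟨M, hM, rfl⟩ := hf
  -- The flattening factors through the pair of end vertices of layer `i`: `C` holds the labels of
  -- that layer, `D` the contribution of all other layers.
  let C : Matrix ι (Fin (w i) × Fin (w (i + 1))) ℂ := Matrix.of fun p e =>
    NCPoly.coeff (M i e.1 e.2) (FreeMonoid.of (u p))
  let D : Matrix (Fin (w i) × Fin (w (i + 1))) ι ℂ := Matrix.of fun e q =>
    ∑ k : (∀ i, Fin (w i)) with (k i, k (i + 1)) = e, ∏ j ∈ Finset.univ.erase i,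
      NCPoly.coeff (M j (k j) (k (j + 1))) (FreeMonoid.of (v q j))
  have hCD : (Matrix.of fun p q : ι => NCPoly.coeff (abpValue M)
      (List.ofFn fun j => FreeMonoid.of (Function.update (v q) i (u p) j)).prod) = C * D := by
    ext p q
    rw [Matrix.of_apply, coeff_abpValue hM, Matrix.mul_apply,
      ← Finset.sum_fiberwise _ fun k : (∀ i, Fin (w i)) => (k i, k (i + 1))]
    refine Finset.sum_congr rfl fun e _ => ?_
    simp only [C, D, Matrix.of_apply, Finset.mul_sum]
    refine Finset.sum_congr rfl fun k hk => ?_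
    rw [Finset.mem_filter_univ] at hk
    rw [← Finset.mul_prod_erase _ _ (Finset.mem_univ i), ← hk, Function.update_self]
    congr 1
    refine Finset.prod_congr rfl fun j hj => ?_
    rw [Function.update_of_ne (Finset.ne_of_mem_erase hj)]
  rw [hCD]
  by_contra hdet
  have h1 := Matrix.rank_of_isUnit (C * D) ((Matrix.isUnit_iff_isUnit_det _).2 (IsUnit.mk0 _ hdet))
  have h2 := (Matrix.rank_mul_le_left C D).trans C.rank_le_card_width
  rw [h1, Fintype.card_prod, Fintype.card_fin, Fintype.card_fin] at h2
  omega

/-- The polynomial `f_0` has flattenings of full rank. -/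
theorem exists_det_flattening_fZero (hd : 2 ≤ d) (hodd : Odd d) {w : Fin d → ℕ}
    (hw : ∀ i, 2 ≤ w i) (i : Fin d) :
    ∃ v : Fin (w i) × Fin (w (i + 1)) → Fin d → EdgeVar w,
      (Matrix.of fun p q : Fin (w i) × Fin (w (i + 1)) => NCPoly.coeff (fZero w)
        (List.ofFn fun j => FreeMonoid.of (Function.update (v q) i ⟨i, p⟩ j)).prod).det = 1 := by
  -- Column `q` is a good path through edge `q` with that edge removed. The remaining edges fix its
  -- endpoints, so only `p = q` closes it up and the flattening is the identity.
  choose k hk1 hk2 hk using fun q : Fin (w i) × Fin (w (i + 1)) =>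
    exists_numPreserving_eq_one hd hodd hw i q.1 q.2
  refine ⟨fun q j => ⟨j, k q j, k q (j + 1)⟩, ?_⟩
  convert Matrix.det_one (n := Fin (w i) × Fin (w (i + 1))) (R := ℂ)
  ext p q
  rw [Matrix.of_apply, coeff_fZero, Matrix.one_apply]
  let Y : ∀ j : Fin d, Matrix (Fin (w j)) (Fin (w (j + 1))) ℂ :=
    Function.update (edgeUnit (k q)) i (Matrix.single p.1 p.2 1)
  have hY := pathForm_eq_entry hd _ (mem_goodPaths.2 (hk q)) i (X := Y)
    fun j hj => Function.update_of_ne hj _ _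
  trans pathForm (goodPaths w) Y
  · refine Finset.sum_congr rfl fun k' _ => Finset.prod_congr rfl fun j _ => ?_
    by_cases hj : j = i
    · subst hj
      simp [Y, Matrix.single_apply, Prod.ext_iff]
    · simp [Y, hj, edgeUnit, Matrix.single_apply]
  · rw [hY]
    simp [Y, Matrix.single_apply, Prod.ext_iff, hk1, hk2]

/-- If `r < m`, the flattening determinants of all `g n` vanish because `r ^ 2 < m ^ 2`, while by
continuity they tend to `1`. -/
theorem le_of_coeffTendsto_fZero (hd : 2 ≤ d) (hodd : Odd d) {w : Fin d → ℕ} (hw : ∀ i, 2 ≤ w i)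
    {m : ℕ} (hm : ∀ i, w i = m) {r : ℕ} {g : ℕ → NCPoly (EdgeVar w)}
    (hg : ∀ n, ComputedByWidth d r (g n)) (hlim : CoeffTendsto g atTop (fZero w)) : m ≤ r := by
  by_contra! hr
  obtain ⟨v, hv⟩ := exists_det_flattening_fZero hd hodd hw 0
  have hdet : Tendsto (fun n => (Matrix.of fun p q : Fin (w 0) × Fin (w (0 + 1)) =>
      NCPoly.coeff (g n) (List.ofFn fun j =>
        FreeMonoid.of (Function.update (v q) 0 ⟨0, p⟩ j)).prod).det) atTop (𝓝 1) := by
    rw [← hv]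
    refine (continuous_id.matrix_det.tendsto _).comp ?_
    refine tendsto_pi_nhds.2 fun p => tendsto_pi_nhds.2 fun q => hlim _
  have h0 (n : ℕ) : (Matrix.of fun p q : Fin (w 0) × Fin (w (0 + 1)) =>
      NCPoly.coeff (g n) (List.ofFn fun j =>
        FreeMonoid.of (Function.update (v q) 0 ⟨0, p⟩ j)).prod).det = 0 := by
    obtain ⟨w', hw', h⟩ := hg n
    refine det_flattening_eq_zero h 0 ?_ (fun p : Fin (w 0) × Fin (w (0 + 1)) => ⟨0, p⟩) v
    rw [Fintype.card_prod, Fintype.card_fin, Fintype.card_fin, hm, hm]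
    exact Nat.mul_lt_mul'' ((hw' _).trans_lt hr) ((hw' _).trans_lt hr)
  simp only [h0] at hdet
  exact zero_ne_one (tendsto_nhds_unique tendsto_const_nhds hdet)

theorem borderNcWidth_fZero (hd : 2 ≤ d) (hodd : Odd d) {w : Fin d → ℕ} (hw : ∀ i, 2 ≤ w i)
    {m : ℕ} (hm : ∀ i, w i = m) : borderNcWidth d (fZero w) = m := by
  have hmem : m ∈ {m : ℕ | ∃ g : ℕ → NCPoly (EdgeVar w), (∀ n, ComputedByWidth d m (g n)) ∧
      CoeffTendsto g atTop (fZero w)} := by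
    refine ⟨fun n => fEps w (1 / ((n : ℂ) + 1)), fun n =>
      ⟨w, fun i => (hm i).le, computedByFormat_fEps w _⟩, fun x => ?_⟩
    refine (tendsto_fEps w hodd x).comp (tendsto_nhdsWithin_iff.2
      ⟨tendsto_one_div_add_atTop_nhds_zero_nat, Eventually.of_forall fun n => ?_⟩)
    exact one_div_ne_zero (Nat.cast_add_one_ne_zero n)
  refine le_antisymm (Nat.sInf_le hmem) ?_
  obtain ⟨g, hg, hlim⟩ := Nat.sInf_mem ⟨m, hmem⟩
  exact le_of_coeffTendsto_fZero hd hodd hw hm hg hlim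

end BorderWidth

theorem mainTheorem1 (d : ℕ) [NeZero d] (hd : 3 ≤ d) (hodd : Odd d)
    (w : Fin d → ℕ) (hw : ∀ i, 2 ≤ w i) :
    -- `f_0` is the limit of `f_ε = (1/ε) f'_ε`, and `f'_ε`, `f_ε` have format-`w` ABPs
    (∀ ε : ℂ, ComputedByFormat w (fEpsPrime w ε)) ∧
    (∀ ε : ℂ, ε ≠ 0 → ComputedByFormat w (fEps w ε)) ∧
    CoeffTendsto (fun ε : ℂ => fEps w ε) (𝓝[≠] 0) (fZero w) ∧
    -- `f_0` itself has no format-`w` ABP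
    ¬ ComputedByFormat w (fZero w) ∧
    -- for a constant format this separates border width from width
    (∀ m : ℕ, (∀ i, w i = m) →
      borderNcWidth d (fZero w) = m ∧ m < ncWidth d (fZero w)) :=
  ⟨computedByFormat_fEpsPrime w, fun ε _ => computedByFormat_fEps w ε, tendsto_fEps w hodd,
    not_computedByFormat_fZero hd hodd hw, fun _ hm =>
      ⟨borderNcWidth_fZero (by omega) hodd hw hm, lt_ncWidth_fZero hd hodd hw hm⟩⟩
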